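/- Let $X=\{x_0,x_1\}$ and $Y=\{y_n\}_{n\ge1}$ be alphabets. For positive integers $s_1,\dots,s_r$ put $\pi_X(y_{s_1}\cdots y_{s_r})=x_0^{s_1-1}x_1\cdots x_0^{s_r-1}x_1$, extend $\pi_X$ linearly to a bijection from the noncommutative series $\mathbb C\langle\!\langle Y\rangle\!\rangle$ onto $\mathbb C\langle\!\langle X\rangle\!\rangle x_1\oplus\mathbb C\,1_{X^*}$, and let $\pi_Y$ be its inverse. For $w=x_0^{s_1-1}x_1\cdots x_0^{s_r-1}x_1$ and $|z|<1$ let $$\operatorname{Li}_w(z)=\sum_{n_1>\cdots>n_r>0}\frac{z^{n_1}}{n_1^{s_1}\cdots n_r^{s_r}},\qquad \operatorname{Li}_{1_{X^*}}=1 ,$$ and extend $\operatorname{Li}$ linearly to polynomials in $\mathbb C\langle X\rangle x_1\oplus\mathbb C\,1_{X^*}$. For a series $S$ let $[S]_n=\sum_{|w|=n}\langle S|w\rangle w$ be its homogeneous component of degree $n$. For $0<R\le1$ let $\mathrm{Dom}_R(\operatorname{Li})$ be the set of $S\in\mathbb C\langle\!\langle X\rangle\!\rangle x_1\oplus\mathbb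 C\,1_{X^*}$ such that $\sum_{n\ge0}\operatorname{Li}_{[S]_n}$ converges unconditionally in the space of holomorphic functions on $\{|z|<R\}$ (with compact convergence), and let $\mathrm{Dom}^{\mathrm{loc}}(\operatorname{Li})=\bigcup_{0<R\le1}\mathrm{Dom}_R(\operatorname{Li})$. For $S\in\mathrm{Dom}^{\mathrm{loc}}(\operatorname{Li})$ put, near $z=0$, $$\operatorname{Li}_S(z)=\sum_{n\ge0}\operatorname{Li}_{[S]_n}(z),\qquad \frac{\operatorname{Li}_S(z)}{1-z}=\sum_{N\ge0}\mathrm H_{\pi_Y(S)}(N)\,z^N .$$ Let $\mathbin{\sqcup\!\sqcup}$ be the shuffle product, given on words by $u\mathbin{\sqcup\!\sqcup}1=1\mathbin{\sqcup\!\sqcup}u=u$ and $au\mathbin{\sqcup\!\sqcup}bv=a(u\mathbin{\sqcup\!\sqcup}bv)+b(au\mathbin{\sqcup\!\sqcup}v)$, and let $*$ be the stuffle product on words over $Y$, given by $u*1=1*u=u$ and $y_su*y_tv=y_s(u*y_tv)+y_t(y_su*v)+y_{s+t}(u*v)$, both extended to series. Let $\odot$ be the Hadamard (coefficientwise) product of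 power series at $0$. **Theorem.** Let $S,T\in\mathrm{Dom}^{\mathrm{loc}}(\operatorname{Li})$. Then $S\mathbin{\sqcup\!\sqcup}T$ and $\pi_X(\pi_Y(S)*\pi_Y(T))$ lie in $\mathrm{Dom}^{\mathrm{loc}}(\operatorname{Li})$. Moreover: 1. If $0<R\le 1$ and $S,T\in\mathrm{Dom}_R(\operatorname{Li})$, then $S\mathbin{\sqcup\!\sqcup}T\in\mathrm{Dom}_R(\operatorname{Li})$ and $\operatorname{Li}_{S\mathbin{\sqcup\!\sqcup}T}(z)=\operatorname{Li}_S(z)\operatorname{Li}_T(z)$ for $|z|<R$. Also $1_{X^*}\in\mathrm{Dom}_1(\operatorname{Li})$ and $\operatorname{Li}_{1_{X^*}}=1$ on $|z|<1$. 2. $\mathrm H_{\pi_Y(S)*\pi_Y(T)}(N)=\mathrm H_{\pi_Y(S)}(N)\,\mathrm H_{\pi_Y(T)}(N)$ for every $N\ge0$. 3. If $0<R_1,R_2\le1$, $S\in\mathrm{Dom}_{R_1}(\operatorname{Li})$ and $T\in\mathrm{Dom}_{R_2}(\operatorname{Li})$, then $\pi_X(\pi_Y(S)*\pi_Y(T))\in\mathrm{Dom}_{R_1R_2}(\operatorname{Li})$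 and, for $|z|<R_1R_2$, the Hadamard product below converges and $$\frac{\operatorname{Li}_S(z)}{1-z}\odot\frac{\operatorname{Li}_T(z)}{1-z}=\frac{\operatorname{Li}_{\pi_X(\pi_Y(S)*\pi_Y(T))}(z)}{1-z}.$$ -/

import Mathlib

open Filter Topology

namespace LocalPolylog

/-- The two-letter alphabet `X = {x₀, x₁}`. -/
inductive X : Type
  | x0 : X
  | x1 : X
  deriving DecidableEq

instance : Fintype X := ⟨{X.x0, X.x1}, fun a => by cases a <;> simp⟩

/-- Words over the alphabet `Y = {y_n : n ≥ 1}`, the letter `y_n` being coded by `n`. -/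
abbrev YWord : Type := List ℕ+

/-- Noncommutative formal power series over an alphabet `A` with complex coefficients, given by
their coefficients on words: `S w` is the coefficient `⟨S | w⟩`. -/
abbrev Series (A : Type) : Type := List A → ℂ

/-- The series `1`, that is, the empty word. -/
def one (A : Type) : Series A
  | [] => 1
  | _ :: _ => 0

/-- The word `π_X(y_{s₁} … y_{s_r}) = x₀^{s₁-1} x₁ … x₀^{s_r-1} x₁`. -/
def wordX : YWord → List X
  | [] => []
  | s :: t => List.replicate ((s : ℕ) - 1) X.x0 ++ X.x1 :: wordX t

theorem replicate_append_inj {a b : ℕ} {u v : List X}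
    (h : List.replicate a X.x0 ++ X.x1 :: u = List.replicate b X.x0 ++ X.x1 :: v) :
    a = b ∧ u = v := by
  induction a generalizing b with
  | zero => cases b <;> simp_all [List.replicate_succ]
  | succ n ih =>
    cases b with
    | zero => simp [List.replicate_succ] at h
    | succ m =>
      simp only [List.replicate_succ, List.cons_append, List.cons.injEq, true_and] at h
      exact ⟨congrArg _ (ih h).1, (ih h).2⟩

theorem wordX_injective : Function.Injective wordX := by
  intro s
  induction s with
  | nil => intro t h; cases t <;> simp [wordX] at h ⊢
  | cons a s ih =>
    intro t h
    cases t with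
    | nil => simp [wordX] at h
    | cons b t =>
      obtain ⟨h1, h2⟩ := replicate_append_inj h
      have ha := a.pos
      have hb := b.pos
      rw [ih h2, PNat.eq (by omega : (a : ℕ) = b)]

/-- `π_Y`: the coefficient of `v` in `π_Y(S)` is the coefficient of `π_X(v)` in `S`. -/
def piY (S : Series X) : Series ℕ+ := fun v => S (wordX v)

/-- `π_X`: the coefficient of `π_X(v)` in `π_X(Q)` is the coefficient of `v` in `Q`, and words
that are not of the form `π_X(v)` have coefficient `0`. -/
noncomputable def piX (Q : Series ℕ+) : Series X := Function.extend wordX Q 0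

/-- The shuffle product of two words, as the multiset of words that occur in it. -/
def shuffleWord {A : Type} : List A → List A → Multiset (List A)
  | [], v => {v}
  | a :: u, [] => {a :: u}
  | a :: u, b :: v =>
    (shuffleWord u (b :: v)).map (a :: ·) + (shuffleWord (a :: u) v).map (b :: ·)
  termination_by u v => u.length + v.length

/-- The stuffle product of two words over `Y`, as the multiset of words that occur in it. -/
def stuffleWord : YWord → YWord → Multiset YWord
  | [], v => {v}
  | s :: u, [] => {s :: u}
  | s :: u, t :: v =>
    (stuffleWord u (t :: v)).map (s :: ·) + (stuffleWord (s :: u) v).map (t :: ·)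
      + (stuffleWord u v).map ((s + t) :: ·)
  termination_by u v => u.length + v.length

/-- The shuffle product of series over `X`: `S ⧢ T = ∑_{u,v} ⟨S|u⟩ ⟨T|v⟩ u ⧢ v`. The sum that
defines each coefficient has finite support, see `shuffle_support_finite`. -/
noncomputable def shuffle (S T : Series X) : Series X := fun w =>
  ∑ᶠ p : List X × List X, S p.1 * T p.2 * ((shuffleWord p.1 p.2).count w : ℂ)

/-- The stuffle product of series over `Y`: the bilinear extension of the stuffle of words. The
sum that defines each coefficient has finite support, see `stuffle_support_finite`. -/
noncomputable def stuffle (P Q : Series ℕ+) : Series ℕ+ := fun w =>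
  ∑ᶠ p : YWord × YWord, P p.1 * Q p.2 * ((stuffleWord p.1 p.2).count w : ℂ)

theorem length_of_mem_shuffleWord {A : Type} (u v : List A) :
    ∀ w ∈ shuffleWord u v, w.length = u.length + v.length := by
  fun_induction shuffleWord u v with
  | case1 v => simp
  | case2 a u => simp
  | case3 a u b v ih1 ih2 =>
    intro w hw
    simp only [Multiset.mem_add, Multiset.mem_map] at hw
    rcases hw with ⟨x, hx, rfl⟩ | ⟨x, hx, rfl⟩
    · have := ih1 x hx
      simp only [List.length_cons] at this ⊢
      omega
    · have := ih2 x hx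
      simp only [List.length_cons] at this ⊢
      omega

theorem shuffle_support_finite (S T : Series X) (w : List X) :
    (Function.support fun p : List X × List X =>
      S p.1 * T p.2 * ((shuffleWord p.1 p.2).count w : ℂ)).Finite := by
  refine ((List.finite_length_le X w.length).prod (List.finite_length_le X w.length)).subset ?_
  intro p hp
  have hw : w ∈ shuffleWord p.1 p.2 := by
    by_contra h
    exact hp (by simp [Multiset.count_eq_zero_of_notMem h])
  have := length_of_mem_shuffleWord _ _ w hw
  constructor <;> simp only [Set.mem_ofPred_eq] <;> omega

/-- The weight `s₁ + … + s_r` of the word `y_{s₁} … y_{s_r}`. -/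
def weight (v : YWord) : ℕ := (v.map (fun s : ℕ+ => (s : ℕ))).sum

theorem weight_of_mem_stuffleWord (u v : YWord) :
    ∀ w ∈ stuffleWord u v, weight w = weight u + weight v := by
  fun_induction stuffleWord u v with
  | case1 v => simp [weight]
  | case2 a u => simp [weight]
  | case3 a u b v ih1 ih2 ih3 =>
    intro w hw
    simp only [Multiset.mem_add, Multiset.mem_map] at hw
    rcases hw with (⟨x, hx, rfl⟩ | ⟨x, hx, rfl⟩) | ⟨x, hx, rfl⟩
    · have := ih1 x hx
      simp only [weight, List.map_cons, List.sum_cons] at this ⊢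
      omega
    · have := ih2 x hx
      simp only [weight, List.map_cons, List.sum_cons] at this ⊢
      omega
    · have := ih3 x hx
      simp only [weight, List.map_cons, List.sum_cons, PNat.add_coe] at this ⊢
      omega

theorem length_wordX (v : YWord) : (wordX v).length = weight v := by
  induction v with
  | nil => simp [wordX, weight]
  | cons s t ih =>
    have := s.pos
    simp only [wordX, weight, List.length_append, List.length_replicate, List.length_cons,
      List.map_cons, List.sum_cons] at ih ⊢
    omega

theorem finite_weight_le (n : ℕ) : {v : YWord | weight v ≤ n}.Finite :=
  ((List.finite_length_le X n).preimage wordX_injective.injOn).subset fun v hv => by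
    simpa [length_wordX] using hv

theorem stuffle_support_finite (P Q : Series ℕ+) (w : YWord) :
    (Function.support fun p : YWord × YWord =>
      P p.1 * Q p.2 * ((stuffleWord p.1 p.2).count w : ℂ)).Finite := by
  refine ((finite_weight_le (weight w)).prod (finite_weight_le (weight w))).subset ?_
  intro p hp
  have hw : w ∈ stuffleWord p.1 p.2 := by
    by_contra h
    exact hp (by simp [Multiset.count_eq_zero_of_notMem h])
  have := weight_of_mem_stuffleWord _ _ w hw
  constructor <;> simp only [Set.mem_ofPred_eq] <;> omega

/-- The polylogarithm
`Li_{s₁,…,s_r}(z) = ∑_{n₁ > … > n_r > 0} z^{n₁} / (n₁^{s₁} … n_r^{s_r})`, for `|z| < 1`.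
For `r = 0` the only index is the empty list, whose term is `1`. -/
noncomputable def polylog (s : YWord) (z : ℂ) : ℂ :=
  ∑' n : {n : List ℕ // n.length = s.length ∧ n.Pairwise (· > ·) ∧ ∀ m ∈ n, 0 < m},
    z ^ n.1.headD 0 / (List.zipWith (fun (m : ℕ) (k : ℕ+) => (m : ℂ) ^ (k : ℕ)) n.1 s).prod

/-- `Li_w` for `w = x₀^{s₁-1} x₁ … x₀^{s_r-1} x₁`. Words not of this form (those ending in `x₀`)
never occur in the series considered; the value there is set to `0`. -/
noncomputable def liWord : List X → ℂ → ℂ := Function.extend wordX polylog 0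

/-- `Li_{[S]_n}(z)`, where `[S]_n = ∑_{|w| = n} ⟨S|w⟩ w` is the homogeneous component of degree
`n` of `S`. -/
noncomputable def liHom (S : Series X) (n : ℕ) (z : ℂ) : ℂ :=
  ∑ w : Fin n → X, S (List.ofFn w) * liWord (List.ofFn w) z

/-- `Dom_R(Li)`: the series `S` in `ℂ⟨⟨X⟩⟩ x₁ ⊕ ℂ 1` for which `∑_n Li_{[S]_n}` converges
unconditionally in the space of holomorphic functions on `|z| < R`, with the topology of compact
convergence. -/
def Dom (R : ℝ) : Set (Series X) :=
  {S | (∀ w, S w ≠ 0 → w = [] ∨ ∃ u, w = u ++ [X.x1]) ∧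
    SummableLocallyUniformlyOn (fun n : ℕ => liHom S n) (Metric.ball 0 R)}

/-- `Dom^loc(Li)`, the union of the `Dom_R(Li)` for `0 < R ≤ 1`. -/
def DomLoc : Set (Series X) := ⋃ R ∈ Set.Ioc (0 : ℝ) 1, Dom R

/-- `Li_S(z) = ∑_n Li_{[S]_n}(z)`. -/
noncomputable def Li (S : Series X) (z : ℂ) : ℂ := ∑' n : ℕ, liHom S n z

/-- The `N`-th Taylor coefficient at `0`. -/
noncomputable def taylorCoeff (f : ℂ → ℂ) (N : ℕ) : ℂ := iteratedDeriv N f 0 / (N.factorial : ℂ)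

/-- `H_Q(N)` for `Q = π_Y(S)`, `S = π_X(Q)`, defined by `Li_S(z)/(1-z) = ∑_N H_{π_Y(S)}(N) z^N`. -/
noncomputable def H (Q : Series ℕ+) (N : ℕ) : ℂ :=
  taylorCoeff (fun z => Li (piX Q) z / (1 - z)) N

/-- The Hadamard product `f ⊙ g` of two functions analytic at `0`: the sum of the power series
whose coefficients are the products of the Taylor coefficients of `f` and `g`. -/
noncomputable def hadamard (f g : ℂ → ℂ) (z : ℂ) : ℂ :=
  ∑' N : ℕ, taylorCoeff f N * taylorCoeff g N * z ^ N

end LocalPolylog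

/-! The algebra takes place in formal power series. Prepending a letter to a word inverts the Euler
operator `z d/dz` after multiplication by `1` or `z/(1-z)`. The Leibniz rule then reproduces the
shuffle recursion (`liSeries_mul`). Dividing by `1 - z` turns Taylor coefficients into partial sums,
which for a word are harmonic sums; the discrete Leibniz rule for their increments reproduces the
stuffle recursion (`harmonicSum_mul`). Both products respect the degree, so the degree-`n` part of a
product is the Cauchy sum of products of homogeneous parts (`sum_graded_product`).

The analysis must justify these Cauchy products, for which absolute convergence is needed.
Unconditional convergence in the space of holomorphic functions supplies it: small tails of all
finite subsums bound sums of absolute values pointwise, integrating over a circle makes the L¹ norms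
summable, and Cauchy's estimate passes to coefficients (`exists_summable_bound_coeff`). At a
slightly smaller radius even the norms `∑ |c_k| r^k` of the homogeneous parts are summable
(`summable_liNorm`).

The shuffle claims follow by multiplying two absolutely convergent series. For the stuffle, the
coefficients of `Li/(1-z)` have the same majorants (`norm_harmonicHom_le`); they are multiplied
termwise, so the weights `r₁^N` and `r₂^N` multiply, whence the radius `R₁R₂`. -/

namespace LocalPolylog

/-! ### Words ending in `x₁` -/

/-- The words of the form `π_X(v)`: the empty word and the words ending in `x₁`. -/
def Admissible (w : List X) : Prop := w = [] ∨ ∃ u, w = u ++ [X.x1]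

theorem admissible_cons {a : X} {w : List X} :
    Admissible (a :: w) ↔ Admissible w ∧ (a = X.x0 → w ≠ []) := by
  rcases List.eq_nil_or_concat w with rfl | ⟨u, b, rfl⟩
  · cases a
    · simp [Admissible, List.cons_eq_append_iff]
    · simp [Admissible]
  · have h : ∀ c v, Admissible (c :: v ++ [b]) ↔ b = X.x1 := fun c v => by
      rw [Admissible, ← List.concat_eq_append]
      constructor
      · rintro (h | ⟨u, h⟩)
        · simp at h
        · rw [← List.concat_eq_append] at h
          exact (List.concat_inj.1 h).2
      · rintro rfl
        exact Or.inr ⟨c :: v, List.concat_eq_append⟩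
    have h' : Admissible (u ++ [b]) ↔ b = X.x1 := by
      cases u with
      | nil => simpa [Admissible, List.cons_eq_append_iff] using eq_comm
      | cons c v => exact h c v
    rw [List.concat_eq_append, ← List.cons_append, h, h']
    simp

theorem admissible_iff {w : List X} : Admissible w ↔ w ∈ Set.range wordX := by
  constructor
  -- The word is read letter by letter, whereas `wordX` is built from blocks `x₀^k x₁`; the claim
  -- therefore carries the `k` letters `x₀` of an unfinished block.
  · suffices h : ∀ k w, Admissible (List.replicate k X.x0 ++ w) → (k = 0 ∨ w ≠ []) →
        List.replicate k X.x0 ++ w ∈ Set.range wordX by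
      intro hw; simpa using h 0 w hw (Or.inl rfl)
    intro k w
    induction w generalizing k with
    | nil =>
      rintro - (rfl | h)
      · exact ⟨[], rfl⟩
      · exact absurd rfl h
    | cons a w ih =>
      intro hw _
      have hrep : ∀ k w, Admissible (List.replicate k X.x0 ++ w) → Admissible w := by
        intro k
        induction k with
        | zero => simp
        | succ k ihk =>
          intro w hw
          rw [List.replicate_succ, List.cons_append, admissible_cons] at hw
          exact ihk w hw.1
      have hw' := admissible_cons.1 (hrep k _ hw)
      cases a with
      | x0 =>
        have e : List.replicate k X.x0 ++ X.x0 :: w = List.replicate (k + 1) X.x0 ++ w := by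
          simp [List.replicate_succ']
        rw [e] at hw ⊢
        exact ih (k + 1) hw (Or.inr (hw'.2 rfl))
      | x1 =>
        obtain ⟨v, hv⟩ := ih 0 (by simpa using hw'.1) (Or.inl rfl)
        refine ⟨⟨k + 1, k.succ_pos⟩ :: v, ?_⟩
        simp [wordX, hv]
  · rintro ⟨v, rfl⟩
    induction v with
    | nil => exact Or.inl rfl
    | cons s v ih =>
      have h : ∀ k, Admissible (List.replicate k X.x0 ++ X.x1 :: wordX v) := by
        intro k
        induction k with
        | zero => simpa using admissible_cons.2 ⟨ih, by simp⟩
        | succ k ihk =>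
          rw [List.replicate_succ, List.cons_append]
          exact admissible_cons.2 ⟨ihk, by simp⟩
      exact h _

theorem shuffleWord_ne_nil {A : Type} {u v w : List A} (hw : w ∈ shuffleWord u v)
    (h : u ≠ [] ∨ v ≠ []) : w ≠ [] := by
  rintro rfl
  have := length_of_mem_shuffleWord u v _ hw
  simp only [List.length_nil] at this
  rcases h with h | h
  · exact h (List.eq_nil_of_length_eq_zero (by omega))
  · exact h (List.eq_nil_of_length_eq_zero (by omega))

theorem admissible_of_mem_shuffleWord (u v : List X) (hu : Admissible u) (hv : Admissible v) :
    ∀ w ∈ shuffleWord u v, Admissible w := by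
  fun_induction shuffleWord u v with
  | case1 v => simpa using hv
  | case2 a u => simpa using hu
  | case3 a u b v ih1 ih2 =>
    have hu' := admissible_cons.1 hu
    have hv' := admissible_cons.1 hv
    intro w hw
    simp only [Multiset.mem_add, Multiset.mem_map] at hw
    rcases hw with ⟨x, hx, rfl⟩ | ⟨x, hx, rfl⟩
    · exact admissible_cons.2 ⟨ih1 hu'.1 hv x hx, fun _ => shuffleWord_ne_nil hx (by simp)⟩
    · exact admissible_cons.2 ⟨ih2 hu hv'.1 x hx, fun _ => shuffleWord_ne_nil hx (by simp)⟩

theorem piY_piX (Q : Series ℕ+) : piY (piX Q) = Q := by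
  funext v
  exact wordX_injective.extend_apply Q 0 v

theorem piX_piY {S : Series X} (hS : ∀ w, S w ≠ 0 → Admissible w) : piX (piY S) = S := by
  funext w
  by_cases hw : w ∈ Set.range wordX
  · obtain ⟨v, rfl⟩ := hw
    exact wordX_injective.extend_apply _ 0 v
  · rw [piX, Function.extend_apply' _ _ _ hw]
    by_contra h
    exact hw (admissible_iff.1 (hS w (Ne.symm h)))

theorem admissible_of_piX_ne_zero (Q : Series ℕ+) (w : List X) (hw : piX Q w ≠ 0) :
    Admissible w := by
  rw [admissible_iff]
  by_contra h
  exact hw (Function.extend_apply' _ _ _ h)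

/-! ### Finite sets of words of given degree, and products of graded series -/

/-- The words of length `n` over `X`. -/
noncomputable def wordsX (n : ℕ) : Finset (List X) := (List.finite_length_eq X n).toFinset

@[simp] theorem mem_wordsX {n : ℕ} {w : List X} : w ∈ wordsX n ↔ w.length = n := by
  simp [wordsX]

/-- The words of weight `n` over `Y`. -/
noncomputable def wordsY (n : ℕ) : Finset YWord :=
  (finite_weight_le n).toFinset.filter fun v => weight v = n

@[simp] theorem mem_wordsY {n : ℕ} {v : YWord} : v ∈ wordsY n ↔ weight v = n := by
  simpa [wordsY] using le_of_eq

theorem sum_ofFn_eq_sum_wordsX {M : Type*} [AddCommMonoid M] (n : ℕ) (f : List X → M) :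
    ∑ w : Fin n → X, f (List.ofFn w) = ∑ w ∈ wordsX n, f w := by
  refine Finset.sum_nbij List.ofFn (by simp) (List.ofFn_injective.injOn) ?_ (by simp)
  intro w hw
  have hw' : w.length = n := by simpa using hw
  subst hw'
  exact ⟨w.get, by simp, by simp⟩

theorem sum_wordsX_eq_sum_wordsY {M : Type*} [AddCommMonoid M] (n : ℕ) (f : List X → M)
    (hf : ∀ w, w ∉ Set.range wordX → f w = 0) :
    ∑ w ∈ wordsX n, f w = ∑ v ∈ wordsY n, f (wordX v) := by
  symm
  refine Finset.sum_of_injOn wordX wordX_injective.injOn ?_ ?_ (by simp)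
  · intro v hv
    simpa [length_wordX] using hv
  · intro w hw hw'
    refine hf w ?_
    rintro ⟨v, rfl⟩
    exact hw' ⟨v, by simpa [length_wordX] using hw, rfl⟩

/-- Common to both products: `φ` is `liSeries` for the shuffle and `harmonicSum` for the stuffle.
Multiplicativity is asked only where both coefficients are nonzero, because `liSeries` is
multiplicative only on admissible words. -/
theorem sum_graded_product {W M : Type*} [DecidableEq W] [CommRing M] [Algebra ℂ M]
    (d : W → ℕ) (B : ℕ → Finset W) (hB : ∀ n w, w ∈ B n ↔ d w = n)
    (m : W → W → Multiset W) (hm : ∀ u v, ∀ w ∈ m u v, d w = d u + d v)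
    (φ : W → M) (S T : W → ℂ)
    (hφ : ∀ u v, S u ≠ 0 → T v ≠ 0 → φ u * φ v = ((m u v).map φ).sum) (k : ℕ) :
    ∑ w ∈ B k, (∑ᶠ p : W × W, S p.1 * T p.2 * ((m p.1 p.2).count w : ℂ)) • φ w =
      ∑ q ∈ Finset.HasAntidiagonal.antidiagonal k,
        (∑ u ∈ B q.1, S u • φ u) * ∑ v ∈ B q.2, T v • φ v := by
  classical
  -- Only pairs of total degree `k` can produce a word of degree `k`, so this finite set replaces
  -- the support of each `finsum`.
  set P : Finset (W × W) := (Finset.HasAntidiagonal.antidiagonal k).biUnion fun q =>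
    B q.1 ×ˢ B q.2 with hP
  have memP : ∀ p : W × W, p ∈ P ↔ d p.1 + d p.2 = k := by
    intro p
    simp only [hP, Finset.mem_biUnion, Finset.HasAntidiagonal.mem_antidiagonal,
      Finset.mem_product, hB]
    exact ⟨fun ⟨q, h1, h2, h3⟩ => by omega, fun h => ⟨(d p.1, d p.2), h, rfl, rfl⟩⟩
  have h1 : ∀ w ∈ B k, ∑ᶠ p : W × W, S p.1 * T p.2 * ((m p.1 p.2).count w : ℂ) =
      ∑ p ∈ P, S p.1 * T p.2 * ((m p.1 p.2).count w : ℂ) := by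
    intro w hw
    refine finsum_eq_sum_of_support_subset _ fun p hp => ?_
    have hw' : w ∈ m p.1 p.2 := by
      by_contra h
      exact hp (by simp [Multiset.count_eq_zero_of_notMem h])
    rw [Finset.mem_coe, memP, ← hm _ _ _ hw', (hB _ _).1 hw]
  have h2 : ∀ p ∈ P, ∑ w ∈ B k, (S p.1 * T p.2 * ((m p.1 p.2).count w : ℂ)) • φ w =
      (S p.1 • φ p.1) * (T p.2 • φ p.2) := by
    intro p hp
    by_cases h : S p.1 = 0 ∨ T p.2 = 0
    · rcases h with h | h <;> simp [h]
    · push Not at h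
      rw [smul_mul_smul_comm, hφ _ _ h.1 h.2, Finset.sum_multiset_map_count, Finset.smul_sum]
      symm
      refine Finset.sum_subset_zero_on_sdiff ?_ ?_ ?_
      · intro w hw
        rw [hB, hm _ _ _ (Multiset.mem_toFinset.1 hw), (memP p).1 hp]
      · intro w hw
        have : w ∉ m p.1 p.2 := by simpa using (Finset.mem_sdiff.1 hw).2
        simp [Multiset.count_eq_zero_of_notMem this]
      · intro w _
        rw [mul_smul (S p.1 * T p.2), Nat.cast_smul_eq_nsmul]
  calc _ = ∑ w ∈ B k, ∑ p ∈ P, (S p.1 * T p.2 * ((m p.1 p.2).count w : ℂ)) • φ w :=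
        Finset.sum_congr rfl fun w hw => by rw [h1 w hw, Finset.sum_smul]
    _ = ∑ p ∈ P, (S p.1 • φ p.1) * (T p.2 • φ p.2) := by
        rw [Finset.sum_comm]
        exact Finset.sum_congr rfl h2
    _ = _ := by
        rw [hP, Finset.sum_biUnion]
        · refine Finset.sum_congr rfl fun q _ => ?_
          rw [Finset.sum_mul_sum, Finset.sum_product]
        · intro q _ q' _ hqq
          refine Finset.disjoint_left.2 fun p hp hp' => hqq ?_
          simp only [Finset.mem_product, hB] at hp hp'
          exact Prod.ext (hp.1.symm.trans hp'.1) (hp.2.symm.trans hp'.2)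

/-! ### Polylogarithms as formal power series -/

/-- The inverse of the Euler operator `z d/dz` on power series without constant term. -/
noncomputable def eulerInv (f : PowerSeries ℂ) : PowerSeries ℂ :=
  PowerSeries.mk fun n => (n : ℂ)⁻¹ * PowerSeries.coeff n f

/-- The differential forms `dz/z` and `dz/(1-z)`, multiplied by `z`. -/
noncomputable def form : X → PowerSeries ℂ
  | .x0 => 1
  | .x1 => PowerSeries.X * PowerSeries.mk 1

/-- The Taylor series at `0` of `Li_w`; it vanishes if `w` ends in `x₀`. -/
noncomputable def liSeries : List X → PowerSeries ℂ
  | [] => 1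
  | a :: w => eulerInv (form a * liSeries w)

/-- The Euler operator `z d/dz`. -/
noncomputable def euler (f : PowerSeries ℂ) : PowerSeries ℂ :=
  PowerSeries.X * PowerSeries.derivative ℂ f

theorem coeff_euler (f : PowerSeries ℂ) (n : ℕ) :
    PowerSeries.coeff n (euler f) = n * PowerSeries.coeff n f := by
  cases n with
  | zero => simp [euler]
  | succ n =>
    rw [euler, PowerSeries.coeff_succ_X_mul, PowerSeries.coeff_derivative]
    push_cast; ring

theorem euler_mul (f g : PowerSeries ℂ) : euler (f * g) = euler f * g + f * euler g := by
  simp only [euler, Derivation.leibniz, smul_eq_mul]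
  ring

theorem euler_eulerInv {f : PowerSeries ℂ} (hf : PowerSeries.coeff 0 f = 0) :
    euler (eulerInv f) = f := by
  ext n
  rw [coeff_euler, eulerInv, PowerSeries.coeff_mk]
  rcases eq_or_ne n 0 with rfl | hn
  · simp [hf]
  · rw [mul_inv_cancel_left₀ (Nat.cast_ne_zero.2 hn)]

theorem eq_of_euler_eq {f g : PowerSeries ℂ} (h : euler f = euler g)
    (h0 : PowerSeries.coeff 0 f = PowerSeries.coeff 0 g) : f = g := by
  ext n
  rcases eq_or_ne n 0 with rfl | hn
  · exact h0
  · have := congrArg (PowerSeries.coeff n) h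
    rw [coeff_euler, coeff_euler] at this
    exact mul_left_cancel₀ (Nat.cast_ne_zero.2 hn) this

/-- The convention `0⁻¹ = 0` makes `eulerInv` discard the constant term. -/
theorem coeff_zero_liSeries {w : List X} (hw : w ≠ []) :
    PowerSeries.coeff 0 (liSeries w) = 0 := by
  cases w with
  | nil => exact absurd rfl hw
  | cons a w => simp [liSeries, eulerInv, PowerSeries.coeff_mk]

/-- `eulerInv` is inverted only on series without constant term. The form of `x₁` has none; that of
`x₀` is `1`, so the remaining word must be nonempty. -/
theorem euler_liSeries_cons {a : X} {w : List X} (h : a = X.x0 → w ≠ []) :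
    euler (liSeries (a :: w)) = form a * liSeries w := by
  refine euler_eulerInv ?_
  cases a with
  | x0 => simpa [form] using coeff_zero_liSeries (h rfl)
  | x1 => simp [form, mul_assoc]

theorem euler_multiset_sum (m : Multiset (PowerSeries ℂ)) :
    euler m.sum = (m.map euler).sum := by
  induction m using Multiset.induction_on with
  | empty => simp [euler]
  | cons a m ih =>
    rw [Multiset.sum_cons, Multiset.map_cons, Multiset.sum_cons, ← ih]
    simp [euler, mul_add]

/-- Both sides have the same image under the Euler operator, by the Leibniz rule and induction, and
the same constant term. Admissibility matters: `liSeries [x₀] = 0`, yet `x₀ ⧢ x₁` contains `x₀x₁`,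
whose series is the dilogarithm. -/
theorem liSeries_mul (u v : List X) (hu : Admissible u) (hv : Admissible v) :
    liSeries u * liSeries v = ((shuffleWord u v).map liSeries).sum := by
  fun_induction shuffleWord u v with
  | case1 v => simp [liSeries]
  | case2 a u => simp [liSeries]
  | case3 a u b v ih1 ih2 =>
    have hu' := admissible_cons.1 hu
    have hv' := admissible_cons.1 hv
    have key : ∀ (c : X) (m : Multiset (List X)), (∀ w ∈ m, w ≠ []) →
        euler (m.map fun w => liSeries (c :: w)).sum = form c * (m.map liSeries).sum := by
      intro c m hm
      rw [euler_multiset_sum, Multiset.map_map, ← Multiset.sum_map_mul_left]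
      exact congrArg _ (Multiset.map_congr rfl fun w hw =>
        euler_liSeries_cons fun _ => hm w hw)
    have key0 : ∀ (c : X) (m : Multiset (List X)),
        PowerSeries.coeff 0 (m.map fun w => liSeries (c :: w)).sum = 0 := by
      intro c m
      rw [map_multiset_sum, Multiset.map_map]
      refine Multiset.sum_eq_zero fun x hx => ?_
      obtain ⟨w, -, rfl⟩ := Multiset.mem_map.1 hx
      exact coeff_zero_liSeries (List.cons_ne_nil _ _)
    rw [Multiset.map_add, Multiset.sum_add, Multiset.map_map, Multiset.map_map]
    refine eq_of_euler_eq ?_ ?_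
    · have e1 := key a (shuffleWord u (b :: v)) fun w hw => shuffleWord_ne_nil hw (by simp)
      have e2 := key b (shuffleWord (a :: u) v) fun w hw => shuffleWord_ne_nil hw (by simp)
      rw [← ih1 hu'.1 hv] at e1
      rw [← ih2 hu hv'.1] at e2
      have e3 : ∀ f g, euler (f + g) = euler f + euler g := fun f g => by simp [euler, mul_add]
      rw [e3, euler_mul, euler_liSeries_cons hu'.2, euler_liSeries_cons hv'.2]
      simp only [Function.comp_def]
      rw [e1, e2]
      ring
    · rw [map_add]
      simp only [Function.comp_def]
      rw [key0, key0]
      have := coeff_zero_liSeries (List.cons_ne_nil a u)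
      simp only [PowerSeries.coeff_zero_eq_constantCoeff, map_mul] at this ⊢
      simp [this]

/-! ### Coefficients and harmonic sums -/

theorem coeff_mk_one_mul (f : PowerSeries ℂ) (N : ℕ) :
    PowerSeries.coeff N (PowerSeries.mk 1 * f) =
      ∑ n ∈ Finset.range (N + 1), PowerSeries.coeff n f := by
  rw [mul_comm, PowerSeries.coeff_mul, Finset.Nat.sum_antidiagonal_eq_sum_range_succ_mk]
  simp

theorem coeff_liSeries_replicate (k : ℕ) (w : List X) (n : ℕ) :
    PowerSeries.coeff n (liSeries (List.replicate k X.x0 ++ w)) =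
      ((n : ℂ) ^ k)⁻¹ * PowerSeries.coeff n (liSeries w) := by
  induction k with
  | zero => simp
  | succ k ih =>
    rw [List.replicate_succ, List.cons_append, liSeries, eulerInv, PowerSeries.coeff_mk, form,
      one_mul, ih, pow_succ, mul_inv]
    ring

/-- Multiplication by `z/(1-z)` sums the coefficients of strictly smaller index, which is the
condition `n₁ > n₂`; the `s` letters of the block contribute one factor `1/(n+1)` each. -/
theorem coeff_succ_liSeries_wordX_cons (s : ℕ+) (v : YWord) (n : ℕ) :
    PowerSeries.coeff (n + 1) (liSeries (wordX (s :: v))) =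
      (((n + 1 : ℕ) : ℂ) ^ (s : ℕ))⁻¹ *
        ∑ m ∈ Finset.range (n + 1), PowerSeries.coeff m (liSeries (wordX v)) := by
  obtain ⟨k, hk⟩ : ∃ k, (s : ℕ) = k + 1 := ⟨s - 1, by have := s.pos; omega⟩
  rw [wordX, coeff_liSeries_replicate, liSeries, eulerInv, PowerSeries.coeff_mk, form, mul_assoc,
    PowerSeries.coeff_succ_X_mul, coeff_mk_one_mul, hk, Nat.add_sub_cancel, pow_succ, mul_inv,
    mul_assoc]

theorem wordX_ne_nil (s : ℕ+) (v : YWord) : wordX (s :: v) ≠ [] := by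
  simp [wordX]

/-- The harmonic sums
`∑_{N ≥ n₁ > … > n_r > 0} 1 / (n₁^{s₁} … n_r^{s_r})`. -/
noncomputable def harmonicSum : YWord → ℕ → ℂ
  | [], _ => 1
  | s :: v, N => ∑ n ∈ Finset.range N, (((n + 1 : ℕ) : ℂ) ^ (s : ℕ))⁻¹ * harmonicSum v n

theorem sum_coeff_liSeries_wordX (v : YWord) (N : ℕ) :
    ∑ n ∈ Finset.range (N + 1), PowerSeries.coeff n (liSeries (wordX v)) = harmonicSum v N := by
  induction v generalizing N with
  | nil => simp [wordX, liSeries, harmonicSum, PowerSeries.coeff_one]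
  | cons s v ih =>
    rw [Finset.sum_range_succ', coeff_zero_liSeries (wordX_ne_nil s v), add_zero, harmonicSum]
    exact Finset.sum_congr rfl fun n _ => by rw [coeff_succ_liSeries_wordX_cons, ih]

/-- Induction on `N` inside the induction on words. The increment of a product is `Δf·g + f·Δg +
Δf·Δg`; these are the three terms of the stuffle recursion, the last one merging the exponents `s`
and `t`. -/
theorem harmonicSum_mul (u v : YWord) (N : ℕ) :
    harmonicSum u N * harmonicSum v N =
      ((stuffleWord u v).map fun w => harmonicSum w N).sum := by
  fun_induction stuffleWord u v generalizing N with
  | case1 v => simp [harmonicSum]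
  | case2 s u => simp [harmonicSum]
  | case3 s u t v ih1 ih2 ih3 =>
    have key : ∀ (r : ℕ+) (m : Multiset YWord) (N : ℕ),
        (m.map fun w => harmonicSum (r :: w) (N + 1)).sum =
          (m.map fun w => harmonicSum (r :: w) N).sum +
            (((N + 1 : ℕ) : ℂ) ^ (r : ℕ))⁻¹ * (m.map fun w => harmonicSum w N).sum := by
      intro r m N
      rw [← Multiset.sum_map_mul_left, ← Multiset.sum_map_add]
      simp only [harmonicSum, Finset.sum_range_succ]
    induction N with
    | zero => simp [harmonicSum, Function.comp_def]
    | succ N ih =>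
      simp only [Multiset.map_add, Multiset.sum_add, Multiset.map_map, Function.comp_def] at ih ⊢
      rw [key, key, key, ← ih1, ← ih2, ← ih3]
      have hs : ∀ (r : ℕ+) w, harmonicSum (r :: w) (N + 1) = harmonicSum (r :: w) N +
          (((N + 1 : ℕ) : ℂ) ^ (r : ℕ))⁻¹ * harmonicSum w N := fun r w => by
        simp only [harmonicSum, Finset.sum_range_succ]
      rw [hs, hs, PNat.add_coe, pow_add, mul_inv]
      linear_combination ih

/-! ### Convergence in the unit disc -/

/-- Absolute convergence in the open unit disc. -/
def ConvergesOnUnitDisc (f : PowerSeries ℂ) : Prop :=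
  ∀ r : ℝ, 0 ≤ r → r < 1 → Summable fun n => ‖PowerSeries.coeff n f‖ * r ^ n

theorem ConvergesOnUnitDisc.mul {f g : PowerSeries ℂ} (hf : ConvergesOnUnitDisc f)
    (hg : ConvergesOnUnitDisc g) : ConvergesOnUnitDisc (f * g) := by
  intro r h0 h1
  have e : ∀ (f : PowerSeries ℂ) n, ‖PowerSeries.coeff n f * (r : ℂ) ^ n‖ =
      ‖PowerSeries.coeff n f‖ * r ^ n := fun f n => by
    simp [abs_of_nonneg h0]
  have h := summable_norm_sum_mul_antidiagonal_of_summable_norm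
    (f := fun n => PowerSeries.coeff n f * (r : ℂ) ^ n)
    (g := fun n => PowerSeries.coeff n g * (r : ℂ) ^ n)
    (by simpa only [e] using hf r h0 h1) (by simpa only [e] using hg r h0 h1)
  refine h.congr fun n => ?_
  rw [← e, PowerSeries.coeff_mul, Finset.sum_mul]
  congr 1
  refine Finset.sum_congr rfl fun p hp => ?_
  rw [← Finset.HasAntidiagonal.mem_antidiagonal.1 hp, pow_add]
  ring

theorem ConvergesOnUnitDisc.eulerInv {f : PowerSeries ℂ} (hf : ConvergesOnUnitDisc f) :
    ConvergesOnUnitDisc (eulerInv f) := by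
  intro r h0 h1
  refine (hf r h0 h1).of_nonneg_of_le (fun n => by positivity) fun n => ?_
  rw [LocalPolylog.eulerInv, PowerSeries.coeff_mk, norm_mul]
  gcongr
  refine mul_le_of_le_one_left (norm_nonneg _) ?_
  rw [norm_inv, Complex.norm_natCast]
  exact Nat.cast_inv_le_one n

theorem convergesOnUnitDisc_one : ConvergesOnUnitDisc 1 := fun r _ _ =>
  summable_of_ne_finset_zero (s := {0}) fun n hn => by
    simp [PowerSeries.coeff_one, Finset.notMem_singleton.1 hn]

theorem convergesOnUnitDisc_form (a : X) : ConvergesOnUnitDisc (form a) := by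
  cases a with
  | x0 => exact convergesOnUnitDisc_one
  | x1 =>
    intro r h0 h1
    refine (summable_geometric_of_lt_one h0 h1).of_nonneg_of_le (fun n => by positivity) fun n => ?_
    refine mul_le_of_le_one_left (by positivity) ?_
    cases n <;> simp [form, PowerSeries.coeff_succ_X_mul]

theorem convergesOnUnitDisc_liSeries (w : List X) : ConvergesOnUnitDisc (liSeries w) := by
  induction w with
  | nil => exact convergesOnUnitDisc_one
  | cons a w ih => exact ((convergesOnUnitDisc_form a).mul ih).eulerInv

/-! ### The polylogarithms are the sums of their Taylor series -/

/-- The strictly decreasing lists of `r` positive integers with largest element `N`; the empty list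
has largest element `0`. -/
def decreasingLists : ℕ → ℕ → Finset (List ℕ)
  | 0, 0 => {[]}
  | 0, _ + 1 => ∅
  | r + 1, N => (Finset.range N).biUnion fun m => (decreasingLists r m).image (N :: ·)

theorem mem_decreasingLists {r N : ℕ} {l : List ℕ} :
    l ∈ decreasingLists r N ↔
      (l.length = r ∧ l.Pairwise (· > ·) ∧ ∀ m ∈ l, 0 < m) ∧ l.headD 0 = N := by
  induction r generalizing N l with
  | zero =>
    cases N with
    | zero =>
      simp only [decreasingLists, Finset.mem_singleton, List.length_eq_zero_iff]
      constructor
      · rintro rfl; simp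
      · exact fun h => h.1.1
    | succ N =>
      simp only [decreasingLists, Finset.notMem_empty, List.length_eq_zero_iff, false_iff]
      rintro ⟨⟨rfl, -⟩, h⟩
      simp at h
  | succ r ih =>
    simp only [decreasingLists, Finset.mem_biUnion, Finset.mem_range, Finset.mem_image, ih]
    constructor
    · rintro ⟨m, hm, l, ⟨⟨hl, hp, hpos⟩, rfl⟩, rfl⟩
      refine ⟨⟨by simp [hl], List.pairwise_cons.2 ⟨fun k hk => ?_, hp⟩, ?_⟩, rfl⟩
      · cases l with
        | nil => simp at hk
        | cons a l =>
          simp only [List.headD_cons] at hm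
          rcases List.mem_cons.1 hk with rfl | hk
          · exact hm
          · exact ((List.pairwise_cons.1 hp).1 k hk).trans hm
      · intro k hk
        rcases List.mem_cons.1 hk with rfl | hk
        · omega
        · exact hpos k hk
    · rintro ⟨⟨hl, hp, hpos⟩, h⟩
      cases l with
      | nil => simp at hl
      | cons a l =>
        simp only [List.headD_cons] at h
        subst h
        rw [List.pairwise_cons] at hp
        refine ⟨_, ?_, l, ⟨⟨by simpa using hl, hp.2, fun m hm =>
          hpos m (List.mem_cons_of_mem _ hm)⟩, rfl⟩, rfl⟩
        cases l with
        | nil => exact hpos a (by simp)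
        | cons b l => exact hp.1 b (by simp)

/-- The term `1 / (n₁^{s₁} … n_r^{s_r})`. -/
noncomputable def harmonicTerm (n : List ℕ) (s : YWord) : ℝ :=
  (List.zipWith (fun (m : ℕ) (k : ℕ+) => (m : ℝ) ^ (k : ℕ)) n s).prod⁻¹

theorem harmonicTerm_nonneg (n : List ℕ) (s : YWord) : 0 ≤ harmonicTerm n s := by
  refine inv_nonneg.2 (List.prod_nonneg fun x hx => ?_)
  obtain ⟨i, hi, rfl⟩ := List.mem_iff_getElem.1 hx
  rw [List.getElem_zipWith]
  positivity

theorem ofReal_harmonicTerm (n : List ℕ) (s : YWord) : (harmonicTerm n s : ℂ) =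
    (List.zipWith (fun (m : ℕ) (k : ℕ+) => (m : ℂ) ^ (k : ℕ)) n s).prod⁻¹ := by
  induction n generalizing s with
  | nil => simp [harmonicTerm]
  | cons a n ih =>
    cases s with
    | nil => simp [harmonicTerm]
    | cons k s =>
      have := ih s
      simp only [harmonicTerm, List.zipWith_cons_cons, List.prod_cons, mul_inv] at this ⊢
      rw [Complex.ofReal_mul, this]
      simp

theorem sum_harmonicTerm (v : YWord) (N : ℕ) :
    ((∑ n ∈ decreasingLists v.length N, harmonicTerm n v : ℝ) : ℂ) =
      PowerSeries.coeff N (liSeries (wordX v)) := by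
  induction v generalizing N with
  | nil =>
    cases N <;> simp [decreasingLists, harmonicTerm, wordX, liSeries, PowerSeries.coeff_one]
  | cons s v ih =>
    cases N with
    | zero => simp [decreasingLists, coeff_zero_liSeries (wordX_ne_nil s v)]
    | succ N =>
      rw [coeff_succ_liSeries_wordX_cons, List.length_cons, decreasingLists, Finset.sum_biUnion]
      · simp_rw [← ih]
        push_cast
        rw [Finset.mul_sum]
        refine Finset.sum_congr rfl fun m _ => ?_
        rw [Finset.sum_image (by simp), Finset.mul_sum]
        refine Finset.sum_congr rfl fun l _ => ?_
        simp [harmonicTerm, mul_comm]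
      · intro m _ m' _ hmm
        refine Finset.disjoint_left.2 fun l hl hl' => hmm ?_
        obtain ⟨l, h, rfl⟩ := Finset.mem_image.1 hl
        obtain ⟨l', h', e⟩ := Finset.mem_image.1 hl'
        obtain rfl : l' = l := (List.cons.inj e).2
        exact (mem_decreasingLists.1 h).2.symm.trans (mem_decreasingLists.1 h').2

/-- The multi-indices are grouped by their largest entry. Each group is finite and the harmonic
terms are nonnegative, so absolute summability of the multiple series reduces to that of the Taylor
series. -/
theorem hasSum_polylog (v : YWord) {z : ℂ} (hz : ‖z‖ < 1) :
    HasSum (fun n => PowerSeries.coeff n (liSeries (wordX v)) * z ^ n) (polylog v z) := by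
  let I := {n : List ℕ // n.length = v.length ∧ n.Pairwise (· > ·) ∧ ∀ m ∈ n, 0 < m}
  let e : (Σ N, {n // n ∈ decreasingLists v.length N}) → I :=
    fun p => ⟨p.2.1, (mem_decreasingLists.1 p.2.2).1⟩
  have he : Function.Bijective e := by
    constructor
    · rintro ⟨N, n, hn⟩ ⟨N', n', hn'⟩ h
      obtain rfl : n = n' := congrArg Subtype.val h
      obtain rfl : N = N' := (mem_decreasingLists.1 hn).2.symm.trans (mem_decreasingLists.1 hn').2
      rfl
    · rintro ⟨n, hn⟩
      exact ⟨⟨_, n, mem_decreasingLists.2 ⟨hn, rfl⟩⟩, rfl⟩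
  have hterm : ∀ p, z ^ (e p).1.headD 0 /
      (List.zipWith (fun (m : ℕ) (k : ℕ+) => (m : ℂ) ^ (k : ℕ)) (e p).1 v).prod =
      (harmonicTerm p.2.1 v : ℂ) * z ^ p.1 := by
    rintro ⟨N, n, hn⟩
    rw [ofReal_harmonicTerm, (mem_decreasingLists.1 hn).2, div_eq_mul_inv, mul_comm]
  have hsum : Summable fun p : Σ N, {n // n ∈ decreasingLists v.length N} =>
      (harmonicTerm p.2.1 v : ℂ) * z ^ p.1 := by
    refine Summable.of_norm ?_
    rw [summable_sigma_of_nonneg fun _ => norm_nonneg _]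
    refine ⟨fun N => (hasSum_fintype _).summable, ?_⟩
    refine (convergesOnUnitDisc_liSeries (wordX v) ‖z‖ (norm_nonneg _) hz).congr fun N => ?_
    rw [tsum_fintype, ← sum_harmonicTerm, Complex.norm_real, Real.norm_of_nonneg
      (Finset.sum_nonneg fun n _ => harmonicTerm_nonneg n v), Finset.sum_mul,
      ← Finset.sum_coe_sort]
    refine Finset.sum_congr rfl fun n _ => ?_
    rw [norm_mul, norm_pow, Complex.norm_real, Real.norm_of_nonneg (harmonicTerm_nonneg _ v)]
  have h : polylog v z = ∑' p : Σ N, {n // n ∈ decreasingLists v.length N},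
      (harmonicTerm p.2.1 v : ℂ) * z ^ p.1 := by
    rw [polylog, ← (Equiv.ofBijective e he).tsum_eq]
    exact tsum_congr hterm
  rw [h]
  have := hsum.hasSum.sigma fun N => (hasSum_fintype _)
  refine this.congr_fun ?_
  intro N
  rw [← sum_harmonicTerm, Finset.sum_coe_sort (decreasingLists v.length N)
    (fun n => (harmonicTerm n v : ℂ) * z ^ N)]
  push_cast
  rw [Finset.sum_mul]

/-- A final `x₀` gives `eulerInv 1 = 0`, in agreement with the default value `0` of `liWord`. -/
theorem liSeries_eq_zero {w : List X} (hw : w ∉ Set.range wordX) : liSeries w = 0 := by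
  rw [← admissible_iff] at hw
  induction w with
  | nil => exact absurd (Or.inl rfl) hw
  | cons a w ih =>
    rw [admissible_cons, not_and_or] at hw
    rcases hw with hw | hw
    · ext n
      simp [liSeries, ih hw, eulerInv]
    · push Not at hw
      obtain ⟨rfl, rfl⟩ := hw
      ext n
      cases n <;> simp [liSeries, form, eulerInv, PowerSeries.coeff_one]

theorem hasSum_liWord (w : List X) {z : ℂ} (hz : ‖z‖ < 1) :
    HasSum (fun n => PowerSeries.coeff n (liSeries w) * z ^ n) (liWord w z) := by
  by_cases hw : w ∈ Set.range wordX
  · obtain ⟨v, rfl⟩ := hw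
    rw [liWord, wordX_injective.extend_apply]
    exact hasSum_polylog v hz
  · rw [liWord, Function.extend_apply' _ _ _ hw, liSeries_eq_zero hw]
    simp [hasSum_zero]

/-! ### Homogeneous components -/

/-- The Taylor series at `0` of `Li_{[S]_n}`. -/
noncomputable def liHomSeries (S : Series X) (n : ℕ) : PowerSeries ℂ :=
  ∑ w ∈ wordsX n, S w • liSeries w

theorem convergesOnUnitDisc_liHomSeries (S : Series X) (n : ℕ) :
    ConvergesOnUnitDisc (liHomSeries S n) := by
  intro r h0 h1
  have h : Summable fun k => ∑ w ∈ wordsX n, ‖S w‖ * (‖PowerSeries.coeff k (liSeries w)‖ * r ^ k) :=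
    summable_sum fun w _ => (convergesOnUnitDisc_liSeries w r h0 h1).mul_left _
  refine h.of_nonneg_of_le (fun n => by positivity) fun k => ?_
  rw [liHomSeries, map_sum]
  simp_rw [← mul_assoc, ← Finset.sum_mul]
  gcongr
  refine (norm_sum_le _ _).trans_eq (Finset.sum_congr rfl fun w _ => ?_)
  rw [PowerSeries.coeff_smul, smul_eq_mul, norm_mul]

theorem hasSum_liHom (S : Series X) (n : ℕ) {z : ℂ} (hz : ‖z‖ < 1) :
    HasSum (fun k => PowerSeries.coeff k (liHomSeries S n) * z ^ k) (liHom S n z) := by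
  rw [liHom, sum_ofFn_eq_sum_wordsX n fun w => S w * liWord w z]
  have h := hasSum_sum (s := wordsX n) fun w _ => (hasSum_liWord w hz).mul_left (S w)
  refine h.congr_fun fun k => ?_
  rw [liHomSeries, map_sum, Finset.sum_mul]
  refine Finset.sum_congr rfl fun w _ => ?_
  rw [PowerSeries.coeff_smul, smul_eq_mul, mul_assoc]

theorem liHomSeries_shuffle {S T : Series X} (hS : ∀ w, S w ≠ 0 → Admissible w)
    (hT : ∀ w, T w ≠ 0 → Admissible w) (n : ℕ) :
    liHomSeries (shuffle S T) n = ∑ q ∈ Finset.HasAntidiagonal.antidiagonal n,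
      liHomSeries S q.1 * liHomSeries T q.2 :=
  sum_graded_product List.length wordsX (fun _ _ => mem_wordsX) shuffleWord
    length_of_mem_shuffleWord liSeries S T
    (fun u v hu hv => liSeries_mul u v (hS u hu) (hT v hv)) n

/-- The Taylor coefficients at `0` of `Li_{[S]_n}(z) / (1 - z)`. -/
noncomputable def harmonicHom (S : Series X) (n N : ℕ) : ℂ :=
  ∑ k ∈ Finset.range (N + 1), PowerSeries.coeff k (liHomSeries S n)

theorem harmonicHom_eq (S : Series X) (n : ℕ) :
    harmonicHom S n = ∑ v ∈ wordsY n, S (wordX v) • harmonicSum v := by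
  funext N
  simp only [harmonicHom, liHomSeries, map_sum, PowerSeries.coeff_smul, smul_eq_mul]
  rw [Finset.sum_comm, sum_wordsX_eq_sum_wordsY n _ fun w hw => by simp [liSeries_eq_zero hw],
    Finset.sum_apply]
  refine Finset.sum_congr rfl fun v _ => ?_
  rw [← Finset.mul_sum, sum_coeff_liSeries_wordX, Pi.smul_apply, smul_eq_mul]

theorem harmonicHom_stuffle (S T : Series X) (n N : ℕ) :
    harmonicHom (piX (stuffle (piY S) (piY T))) n N =
      ∑ q ∈ Finset.HasAntidiagonal.antidiagonal n, harmonicHom S q.1 N * harmonicHom T q.2 N := by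
  have h := sum_graded_product weight wordsY (fun _ _ => mem_wordsY) stuffleWord
    weight_of_mem_stuffleWord harmonicSum (piY S) (piY T) (fun u v _ _ => by
      funext N
      have e := map_multiset_sum (Pi.evalAddMonoidHom (fun _ : ℕ => ℂ) N)
        ((stuffleWord u v).map harmonicSum)
      rw [Multiset.map_map] at e
      exact (harmonicSum_mul u v N).trans e.symm) n
  simp_rw [harmonicHom_eq, show ∀ v, piX (stuffle (piY S) (piY T)) (wordX v) =
    stuffle (piY S) (piY T) v from congrFun (piY_piX _)]
  refine (congrFun h N).trans ?_
  simp only [Finset.sum_apply, Pi.mul_apply]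
  rfl

/-! ### Unconditional convergence of power series -/

/-- Real and imaginary parts are each split by sign; on each of the four pieces the absolute values
add up to the modulus of a subsum, hence to at most `C`. -/
theorem sum_norm_le_of_norm_sum_le {ι : Type*} {F : Finset ι} {f : ι → ℂ} {C : ℝ}
    (h : ∀ G ⊆ F, ‖∑ i ∈ G, f i‖ ≤ C) : ∑ i ∈ F, ‖f i‖ ≤ 4 * C := by
  have real : ∀ g : ι → ℝ, (∀ G ⊆ F, |∑ i ∈ G, g i| ≤ C) → ∑ i ∈ F, |g i| ≤ 2 * C := by
    intro g hg
    rw [← Finset.sum_filter_add_sum_filter_not F (fun i => 0 ≤ g i)]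
    have h1 : ∑ i ∈ F with 0 ≤ g i, |g i| = ∑ i ∈ F with 0 ≤ g i, g i :=
      Finset.sum_congr rfl fun i hi => abs_of_nonneg (Finset.mem_filter.1 hi).2
    have h2 : ∑ i ∈ F with ¬0 ≤ g i, |g i| = -∑ i ∈ F with ¬0 ≤ g i, g i := by
      rw [← Finset.sum_neg_distrib]
      exact Finset.sum_congr rfl fun i hi => abs_of_neg (not_le.1 (Finset.mem_filter.1 hi).2)
    have h3 := (abs_le.1 (hg _ (Finset.filter_subset (fun i => 0 ≤ g i) F))).2
    have h4 := (abs_le.1 (hg _ (Finset.filter_subset (fun i => ¬0 ≤ g i) F))).1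
    linarith
  have hre := real (fun i => (f i).re) fun G hG => by
    rw [← Complex.re_sum]; exact (Complex.abs_re_le_norm _).trans (h G hG)
  have him := real (fun i => (f i).im) fun G hG => by
    rw [← Complex.im_sum]; exact (Complex.abs_im_le_norm _).trans (h G hG)
  calc ∑ i ∈ F, ‖f i‖ ≤ ∑ i ∈ F, (|(f i).re| + |(f i).im|) :=
        Finset.sum_le_sum fun i _ => Complex.norm_le_abs_re_add_abs_im _
    _ ≤ 4 * C := by rw [Finset.sum_add_distrib]; linarith

theorem hasFPowerSeriesOnBall_ofScalars {c : ℕ → ℂ} {f : ℂ → ℂ} {R : ℝ} (hR : 0 < R)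
    (h : ∀ z, ‖z‖ < R → HasSum (fun n => c n * z ^ n) (f z)) :
    HasFPowerSeriesOnBall f (FormalMultilinearSeries.ofScalars ℂ c) 0 (ENNReal.ofReal R) where
  r_le := by
    refine ENNReal.le_of_forall_nnreal_lt fun r hr => ?_
    have hr' : (r : ℝ) < R := by
      rw [← ENNReal.ofReal_coe_nnreal] at hr
      exact (ENNReal.ofReal_lt_ofReal_iff hR).1 hr
    refine FormalMultilinearSeries.le_radius_of_tendsto _ (l := 0) ?_
    have h1 := (h (r : ℂ) (by simpa using hr')).summable.tendsto_atTop_zero.norm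
    simpa [FormalMultilinearSeries.ofScalars_norm] using h1
  r_pos := by simpa using hR
  hasSum := by
    intro z hz
    have hz' : ‖z‖ < R := by
      simpa [Metric.eball_ofReal] using hz
    rw [zero_add]
    refine (h z hz').congr_fun fun n => ?_
    rw [FormalMultilinearSeries.ofScalars_apply_eq, smul_eq_mul]

theorem taylorCoeff_eq {c : ℕ → ℂ} {f : ℂ → ℂ} {R : ℝ} (hR : 0 < R)
    (h : ∀ z, ‖z‖ < R → HasSum (fun n => c n * z ^ n) (f z)) (n : ℕ) : taylorCoeff f n = c n := by
  have h1 := (hasFPowerSeriesOnBall_ofScalars hR h).hasFPowerSeriesAt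
  have h2 := h1.analyticAt.hasFPowerSeriesAt.eq_formalMultilinearSeries h1
  exact congrFun (FormalMultilinearSeries.ofScalars_series_injective ℂ ℂ h2) n

/-- Cauchy's estimate is kept with the mean over the circle: unlike a supremum, an integral commutes
with the finite sums over `i` to be bounded next. -/
theorem norm_coeff_mul_pow_le_integral {c : ℕ → ℂ} {f : ℂ → ℂ} {r R : ℝ} (hr : 0 < r) (hrR : r < R)
    (h : ∀ z, ‖z‖ < R → HasSum (fun n => c n * z ^ n) (f z)) (n : ℕ) :
    ‖c n‖ * r ^ n ≤ (2 * Real.pi)⁻¹ * ∫ θ in (0 : ℝ)..2 * Real.pi, ‖f (circleMap 0 r θ)‖ := by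
  have h1 := hasFPowerSeriesOnBall_ofScalars (hr.trans hrR) h
  lift r to NNReal using hr.le
  have hd : DifferentiableOn ℂ f (Metric.closedBall 0 r) := by
    refine h1.differentiableOn.mono fun z hz => ?_
    rw [Metric.eball_ofReal]
    exact Metric.closedBall_subset_ball hrR hz
  have h2 := (hd.hasFPowerSeriesOnBall (by exact_mod_cast hr)).hasFPowerSeriesAt
  have h3 := norm_cauchyPowerSeries_le f 0 r n
  rw [h2.eq_formalMultilinearSeries h1.hasFPowerSeriesAt,
    FormalMultilinearSeries.ofScalars_norm, abs_of_pos hr, inv_pow] at h3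
  rwa [← le_div_iff₀ (by positivity)]

theorem exists_summable_bound_coeff {p : ℕ → PowerSeries ℂ} {f : ℕ → ℂ → ℂ} {r R : ℝ}
    (hp : ∀ i z, ‖z‖ < R → HasSum (fun n => PowerSeries.coeff n (p i) * z ^ n) (f i z))
    (hf : SummableLocallyUniformlyOn f (Metric.ball 0 R)) (hr : 0 < r) (hrR : r < R) :
    ∃ M : ℕ → ℝ, Summable M ∧ ∀ i n, ‖PowerSeries.coeff n (p i)‖ * r ^ n ≤ M i := by
  classical
  have hcont : ∀ i, Continuous fun θ : ℝ => ‖f i (circleMap 0 r θ)‖ := by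
    intro i
    have h1 := hasFPowerSeriesOnBall_ofScalars (hr.trans hrR) (hp i)
    refine (h1.continuousOn.comp_continuous (continuous_circleMap 0 r) fun θ => ?_).norm
    rw [Metric.eball_ofReal]
    simpa [abs_of_pos hr] using hrR
  refine ⟨fun i => (2 * Real.pi)⁻¹ * ∫ θ in (0 : ℝ)..2 * Real.pi, ‖f i (circleMap 0 r θ)‖, ?_,
    fun i n => norm_coeff_mul_pow_le_integral hr hrR (hp i) n⟩
  refine Summable.mul_left _ ?_
  obtain ⟨g, hg⟩ := hf
  have hsub : Metric.closedBall (0 : ℂ) r ⊆ Metric.ball 0 R := Metric.closedBall_subset_ball hrR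
  have hu : TendstoUniformlyOn (fun F : Finset ℕ => fun z => ∑ i ∈ F, f i z) g atTop
      (Metric.closedBall 0 r) :=
    (tendstoLocallyUniformlyOn_iff_tendstoUniformlyOn_of_compact
      (isCompact_closedBall 0 r)).1 (TendstoLocallyUniformlyOn.mono hg hsub)
  obtain ⟨F₀, hF₀⟩ := eventually_atTop.1 (Metric.tendstoUniformlyOn_iff.1 hu 1 one_pos)
  -- The partial sums over `F₀` and `F₀ ∪ G` are both within `1` of the limit, hence within `2` of
  -- each other.
  have htail : ∀ G : Finset ℕ, Disjoint F₀ G → ∀ z ∈ Metric.closedBall (0 : ℂ) r,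
      ‖∑ i ∈ G, f i z‖ ≤ 2 := by
    intro G hG z hz
    have h1 := hF₀ F₀ le_rfl z hz
    have h2 := hF₀ (F₀ ∪ G) Finset.subset_union_left z hz
    rw [Finset.sum_union hG] at h2
    have h3 := dist_triangle_left (∑ i ∈ F₀, f i z) (∑ i ∈ F₀, f i z + ∑ i ∈ G, f i z) (g z)
    rw [dist_self_add_right] at h3
    linarith
  have hint : ∀ i, IntervalIntegrable (fun θ : ℝ => ‖f i (circleMap 0 r θ)‖)
      MeasureTheory.volume 0 (2 * Real.pi) := fun i => (hcont i).intervalIntegrable _ _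
  have hnonneg : ∀ i, 0 ≤ ∫ θ in (0 : ℝ)..2 * Real.pi, ‖f i (circleMap 0 r θ)‖ := fun i =>
    intervalIntegral.integral_nonneg Real.two_pi_pos.le fun _ _ => norm_nonneg _
  -- Away from `F₀`, the tail bound `2` gives the pointwise bound `4 · 2 = 8`, integrated over an
  -- interval of length `2π`; the terms in `F₀` are added separately.
  refine summable_of_sum_le (c := 2 * Real.pi * 8 +
    ∑ i ∈ F₀, ∫ θ in (0 : ℝ)..2 * Real.pi, ‖f i (circleMap 0 r θ)‖) hnonneg fun G => ?_
  have h1 : ∑ i ∈ G \ F₀, ∫ θ in (0 : ℝ)..2 * Real.pi, ‖f i (circleMap 0 r θ)‖ ≤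
      2 * Real.pi * 8 := by
    rw [← intervalIntegral.integral_finsetSum fun i _ => hint i]
    have h2 : ∫ θ in (0 : ℝ)..2 * Real.pi, ∑ i ∈ G \ F₀, ‖f i (circleMap 0 r θ)‖ ≤
        ∫ _ in (0 : ℝ)..2 * Real.pi, (8 : ℝ) := by
      refine intervalIntegral.integral_mono_on Real.two_pi_pos.le
        ((continuous_finsetSum _ fun i _ => hcont i).intervalIntegrable _ _)
        (continuous_const.intervalIntegrable _ _) fun θ _ => ?_
      refine (sum_norm_le_of_norm_sum_le (C := 2) fun H hH => ?_).trans_eq (by norm_num)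
      refine htail H ?_ _ (by simp [abs_of_pos hr])
      exact Finset.disjoint_of_subset_right hH Finset.disjoint_sdiff
    simpa using h2
  calc ∑ i ∈ G, ∫ θ in (0 : ℝ)..2 * Real.pi, ‖f i (circleMap 0 r θ)‖
      ≤ ∑ i ∈ (G \ F₀) ∪ F₀, ∫ θ in (0 : ℝ)..2 * Real.pi, ‖f i (circleMap 0 r θ)‖ :=
        Finset.sum_le_sum_of_subset_of_nonneg (by simp) fun i _ _ => hnonneg i
    _ = _ := Finset.sum_union Finset.sdiff_disjoint
    _ ≤ _ := by gcongr

/-! ### The domain of `Li` -/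

/-- The majorant `∑_k |c_k| r^k` of `Li_{[S]_n}(z) = ∑_k c_k z^k` on `|z| ≤ r`. -/
noncomputable def liNorm (S : Series X) (r : ℝ) (n : ℕ) : ℝ :=
  ∑' k, ‖PowerSeries.coeff k (liHomSeries S n)‖ * r ^ k

/-- The coefficient bound is taken at a radius `r'` between `r` and `R`; the sum over `k` then costs
only the geometric factor `1/(1 - r/r')`. -/
theorem summable_liNorm {S : Series X} {r R : ℝ} (hS : S ∈ Dom R) (hR : R ≤ 1) (h0 : 0 ≤ r)
    (hr : r < R) : Summable (liNorm S r) := by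
  obtain ⟨r', h1, h2⟩ := exists_between hr
  have hr' := h0.trans_lt h1
  obtain ⟨M, hM, hb⟩ := exists_summable_bound_coeff
    (fun i z hz => hasSum_liHom S i (hz.trans_le hR)) hS.2 hr' h2
  have hq : r / r' < 1 := (div_lt_one hr').2 h1
  have hq0 : 0 ≤ r / r' := by positivity
  refine (hM.mul_right (1 - r / r')⁻¹).of_nonneg_of_le
    (fun n => tsum_nonneg fun k => by positivity) fun n => ?_
  rw [← tsum_geometric_of_lt_one hq0 hq, ← tsum_mul_left]
  refine Summable.tsum_le_tsum (fun k => ?_)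
    (convergesOnUnitDisc_liHomSeries S n r h0 (hr.trans_le hR))
    ((summable_geometric_of_lt_one hq0 hq).mul_left _)
  calc _ = ‖PowerSeries.coeff k (liHomSeries S n)‖ * r' ^ k * (r / r') ^ k := by
        rw [div_pow]; field_simp
    _ ≤ _ := by gcongr; exact hb n k

theorem norm_liHom_le (S : Series X) (n : ℕ) {r : ℝ} (hr : r < 1) {z : ℂ} (hz : ‖z‖ ≤ r) :
    ‖liHom S n z‖ ≤ liNorm S r n := by
  have h0 := (norm_nonneg z).trans hz
  rw [← (hasSum_liHom S n (hz.trans_lt hr)).tsum_eq]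
  refine tsum_of_norm_bounded (convergesOnUnitDisc_liHomSeries S n r h0 hr).hasSum fun k => ?_
  rw [norm_mul, norm_pow]
  gcongr

theorem mem_Dom_of_bound {S : Series X} {R : ℝ} (hR : 0 < R) (hS : ∀ w, S w ≠ 0 → Admissible w)
    (h : ∀ r, 0 < r → r < R → ∃ M : ℕ → ℝ, Summable M ∧ ∀ n z, ‖z‖ ≤ r → ‖liHom S n z‖ ≤ M n) :
    S ∈ Dom R := by
  refine ⟨hS, SummableLocallyUniformlyOn_of_locally_bounded Metric.isOpen_ball fun K hK hc => ?_⟩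
  obtain ⟨r, hr, hKr⟩ := exists_pos_lt_subset_ball hR hc.isClosed hK
  obtain ⟨M, hM, hb⟩ := h r hr.1 hr.2
  exact ⟨M, hM, fun n z hz => hb n z (mem_ball_zero_iff.1 (hKr hz)).le⟩

theorem Dom_anti {R R' : ℝ} (h : R ≤ R') : Dom R' ⊆ Dom R := fun _ hS =>
  ⟨hS.1, hS.2.mono (Metric.ball_subset_ball h)⟩

/-! ### Shuffle product -/

theorem hasSum_coeff_mul {f g : PowerSeries ℂ} (hf : ConvergesOnUnitDisc f)
    (hg : ConvergesOnUnitDisc g) {z a b : ℂ} (hz : ‖z‖ < 1)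
    (ha : HasSum (fun n => PowerSeries.coeff n f * z ^ n) a)
    (hb : HasSum (fun n => PowerSeries.coeff n g * z ^ n) b) :
    HasSum (fun n => PowerSeries.coeff n (f * g) * z ^ n) (a * b) := by
  have hn : ∀ {f : PowerSeries ℂ}, ConvergesOnUnitDisc f →
      Summable fun n => ‖PowerSeries.coeff n f * z ^ n‖ := fun h => by
    simpa only [norm_mul, norm_pow] using h ‖z‖ (norm_nonneg z) hz
  have h := tsum_mul_tsum_eq_tsum_sum_antidiagonal_of_summable_norm (hn hf) (hn hg)
  rw [ha.tsum_eq, hb.tsum_eq] at h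
  rw [h]
  have e : ∀ n, ∑ p ∈ Finset.HasAntidiagonal.antidiagonal n,
      PowerSeries.coeff p.1 f * z ^ p.1 * (PowerSeries.coeff p.2 g * z ^ p.2) =
      PowerSeries.coeff n (f * g) * z ^ n := fun n => by
    rw [PowerSeries.coeff_mul, Finset.sum_mul]
    refine Finset.sum_congr rfl fun p hp => ?_
    rw [← Finset.HasAntidiagonal.mem_antidiagonal.1 hp, pow_add]
    ring
  simp_rw [e]
  exact (hn (hf.mul hg)).of_norm.hasSum

theorem summable_sum_antidiagonal {M M' : ℕ → ℝ} (hM : Summable M) (hM' : Summable M')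
    (h0 : ∀ n, 0 ≤ M n) (h0' : ∀ n, 0 ≤ M' n) :
    Summable fun n => ∑ q ∈ Finset.HasAntidiagonal.antidiagonal n, M q.1 * M' q.2 :=
  summable_sum_mul_antidiagonal_of_summable_mul (hM.mul_of_nonneg hM' h0 h0')

theorem liNorm_nonneg (S : Series X) {r : ℝ} (h0 : 0 ≤ r) (n : ℕ) : 0 ≤ liNorm S r n :=
  tsum_nonneg fun k => by positivity

theorem liHom_shuffle {S T : Series X} (hS : ∀ w, S w ≠ 0 → Admissible w)
    (hT : ∀ w, T w ≠ 0 → Admissible w) (n : ℕ) {z : ℂ} (hz : ‖z‖ < 1) :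
    liHom (shuffle S T) n z = ∑ q ∈ Finset.HasAntidiagonal.antidiagonal n,
      liHom S q.1 z * liHom T q.2 z := by
  refine (hasSum_liHom _ n hz).unique ?_
  rw [liHomSeries_shuffle hS hT]
  simp_rw [map_sum, Finset.sum_mul]
  exact hasSum_sum fun q _ => hasSum_coeff_mul (convergesOnUnitDisc_liHomSeries S q.1)
    (convergesOnUnitDisc_liHomSeries T q.2) hz (hasSum_liHom S q.1 hz) (hasSum_liHom T q.2 hz)

theorem admissible_of_shuffle_ne_zero {S T : Series X} (hS : ∀ w, S w ≠ 0 → Admissible w)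
    (hT : ∀ w, T w ≠ 0 → Admissible w) (w : List X) (hw : shuffle S T w ≠ 0) : Admissible w := by
  obtain ⟨p, hp⟩ : ∃ p : List X × List X,
      S p.1 * T p.2 * ((shuffleWord p.1 p.2).count w : ℂ) ≠ 0 := by
    by_contra! h
    exact hw (finsum_eq_zero_of_forall_eq_zero h)
  have h1 : S p.1 ≠ 0 := fun h => hp (by simp [h])
  have h2 : T p.2 ≠ 0 := fun h => hp (by simp [h])
  refine admissible_of_mem_shuffleWord _ _ (hS _ h1) (hT _ h2) w ?_
  by_contra h
  exact hp (by simp [Multiset.count_eq_zero_of_notMem h])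

theorem shuffle_mem_Dom {S T : Series X} {R : ℝ} (h0 : 0 < R) (hR : R ≤ 1) (hS : S ∈ Dom R)
    (hT : T ∈ Dom R) : shuffle S T ∈ Dom R := by
  refine mem_Dom_of_bound h0 (admissible_of_shuffle_ne_zero hS.1 hT.1) fun r hr hrR => ?_
  refine ⟨_, summable_sum_antidiagonal (summable_liNorm hS hR hr.le hrR)
    (summable_liNorm hT hR hr.le hrR) (liNorm_nonneg S hr.le) (liNorm_nonneg T hr.le),
    fun n z hz => ?_⟩
  have hr1 := hrR.trans_le hR
  rw [liHom_shuffle hS.1 hT.1 n (hz.trans_lt hr1)]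
  refine (norm_sum_le _ _).trans (Finset.sum_le_sum fun q _ => ?_)
  rw [norm_mul]
  exact mul_le_mul (norm_liHom_le S _ hr1 hz) (norm_liHom_le T _ hr1 hz) (norm_nonneg _)
    (liNorm_nonneg S hr.le _)

theorem summable_norm_liHom {S : Series X} {R : ℝ} (hR : R ≤ 1) (hS : S ∈ Dom R) {z : ℂ}
    (hz : ‖z‖ < R) : Summable fun n => ‖liHom S n z‖ :=
  (summable_liNorm hS hR (norm_nonneg z) hz).of_nonneg_of_le (fun _ => norm_nonneg _)
    fun n => norm_liHom_le S n (hz.trans_le hR) le_rfl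

theorem Li_shuffle {S T : Series X} {R : ℝ} (hR : R ≤ 1) (hS : S ∈ Dom R) (hT : T ∈ Dom R) {z : ℂ}
    (hz : ‖z‖ < R) : Li (shuffle S T) z = Li S z * Li T z := by
  rw [Li, Li, Li, tsum_mul_tsum_eq_tsum_sum_antidiagonal_of_summable_norm
    (summable_norm_liHom hR hS hz) (summable_norm_liHom hR hT hz)]
  exact tsum_congr fun n => liHom_shuffle hS.1 hT.1 n (hz.trans_le hR)

/-! ### The unit -/

theorem liHom_one_zero (z : ℂ) : liHom (one X) 0 z = 1 := by
  have h : liWord [] z = polylog [] z := congrFun (wordX_injective.extend_apply polylog 0 []) z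
  have hp : polylog [] z = 1 := by
    rw [polylog, tsum_eq_single ⟨[], by simp⟩]
    · simp
    · rintro ⟨n, hn⟩ hne
      exact absurd (Subtype.ext (List.length_eq_zero_iff.1 hn.1)) hne
  simp [liHom, one, h, hp]

theorem liHom_one_succ (n : ℕ) (z : ℂ) : liHom (one X) (n + 1) z = 0 := by
  simp [liHom, one]

theorem one_mem_Dom : one X ∈ Dom 1 := by
  refine mem_Dom_of_bound one_pos ?_ fun r _ _ => ⟨fun n => if n = 0 then 1 else 0, ?_, ?_⟩
  · intro w hw
    cases w with
    | nil => exact Or.inl rfl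
    | cons a w => exact absurd rfl hw
  · exact (hasSum_ite_eq 0 (1 : ℝ)).summable
  · intro n z _
    cases n with
    | zero => simp [liHom_one_zero]
    | succ n => simp [liHom_one_succ]

theorem Li_one (z : ℂ) : Li (one X) z = 1 := by
  rw [Li, tsum_eq_single 0, liHom_one_zero]
  intro n hn
  obtain ⟨m, rfl⟩ := Nat.exists_eq_succ_of_ne_zero hn
  exact liHom_one_succ m z

/-! ### Stuffle product -/

/-- The Taylor coefficients at `0` of `Li_S(z) / (1 - z)`. -/
noncomputable def harmonicCoeff (S : Series X) (N : ℕ) : ℂ := ∑' n, harmonicHom S n N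

/-- Since `r < 1`, `r^N ≤ r^k` for every `k ≤ N`: passing to partial sums does not enlarge the
majorant. -/
theorem norm_harmonicHom_le (S : Series X) {r : ℝ} (h0 : 0 ≤ r) (hr : r < 1) (n N : ℕ) :
    ‖harmonicHom S n N‖ * r ^ N ≤ liNorm S r n := by
  calc ‖harmonicHom S n N‖ * r ^ N
      ≤ (∑ k ∈ Finset.range (N + 1), ‖PowerSeries.coeff k (liHomSeries S n)‖) * r ^ N := by
        gcongr; exact norm_sum_le _ _
    _ ≤ ∑ k ∈ Finset.range (N + 1), ‖PowerSeries.coeff k (liHomSeries S n)‖ * r ^ k := by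
        rw [Finset.sum_mul]
        refine Finset.sum_le_sum fun k hk => ?_
        exact mul_le_mul_of_nonneg_left (pow_le_pow_of_le_one h0 hr.le
          (Nat.lt_succ_iff.1 (Finset.mem_range.1 hk))) (norm_nonneg _)
    _ ≤ liNorm S r n := Summable.sum_le_tsum _ (fun k _ => by positivity)
        (convergesOnUnitDisc_liHomSeries S n r h0 hr)

theorem hasSum_harmonicHom (S : Series X) (n : ℕ) {z : ℂ} (hz : ‖z‖ < 1) :
    HasSum (fun N => harmonicHom S n N * z ^ N) (liHom S n z / (1 - z)) := by
  have h1 : ConvergesOnUnitDisc (PowerSeries.mk 1) := fun r h0 h1 => by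
    simpa using summable_geometric_of_lt_one h0 h1
  have h := hasSum_coeff_mul h1 (convergesOnUnitDisc_liHomSeries S n) hz
    (by simpa using hasSum_geometric_of_norm_lt_one hz) (hasSum_liHom S n hz)
  simp_rw [coeff_mk_one_mul] at h
  rwa [div_eq_inv_mul]

theorem summable_norm_harmonicHom {S : Series X} {R : ℝ} (h0 : 0 < R) (hR : R ≤ 1) (hS : S ∈ Dom R)
    (N : ℕ) : Summable fun n => ‖harmonicHom S n N‖ := by
  obtain ⟨r, hr, hrR⟩ := exists_between h0
  refine ((summable_liNorm hS hR hr.le hrR).mul_right (r ^ N)⁻¹).of_nonneg_of_le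
    (fun _ => norm_nonneg _) fun n => ?_
  rw [← div_eq_mul_inv, le_div_iff₀ (by positivity)]
  exact norm_harmonicHom_le S hr.le (hrR.trans_le hR) n N

/-- Summation over degrees and over Taylor indices is interchanged; the double family is dominated
by `liNorm S r n * (‖z‖ / r) ^ N` with `‖z‖ < r < R`. -/
theorem hasSum_harmonicCoeff {S : Series X} {R : ℝ} (hR : R ≤ 1) (hS : S ∈ Dom R) {z : ℂ}
    (hz : ‖z‖ < R) : HasSum (fun N => harmonicCoeff S N * z ^ N) (Li S z / (1 - z)) := by
  obtain ⟨r, h1, h2⟩ := exists_between hz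
  have hr : 0 < r := (norm_nonneg z).trans_lt h1
  have hsum : Summable fun p : ℕ × ℕ => harmonicHom S p.1 p.2 * z ^ p.2 := by
    have hM : Summable fun p : ℕ × ℕ => liNorm S r p.1 * (‖z‖ / r) ^ p.2 :=
      (summable_liNorm hS hR hr.le h2).mul_of_nonneg
        (summable_geometric_of_lt_one (by positivity) ((div_lt_one hr).2 h1))
        (liNorm_nonneg S hr.le) fun _ => by positivity
    refine Summable.of_norm_bounded hM fun p => ?_
    calc ‖harmonicHom S p.1 p.2 * z ^ p.2‖
        = ‖harmonicHom S p.1 p.2‖ * r ^ p.2 * (‖z‖ / r) ^ p.2 := by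
          rw [norm_mul, norm_pow, div_pow]; field_simp
      _ ≤ _ := by gcongr; exact norm_harmonicHom_le S hr.le (h2.trans_le hR) _ _
  have h3 : HasSum (fun n => liHom S n z / (1 - z))
      (∑' p : ℕ × ℕ, harmonicHom S p.1 p.2 * z ^ p.2) :=
    hsum.hasSum.prod_fiberwise fun n => hasSum_harmonicHom S n (hz.trans_le hR)
  have h5 : Li S z / (1 - z) = ∑' p : ℕ × ℕ, harmonicHom S p.1 p.2 * z ^ p.2 := by
    rw [Li, ← tsum_div_const, h3.tsum_eq]
  rw [h5]
  have h4 : HasSum (fun p : ℕ × ℕ => harmonicHom S p.2 p.1 * z ^ p.1)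
      (∑' p : ℕ × ℕ, harmonicHom S p.1 p.2 * z ^ p.2) :=
    (Equiv.prodComm ℕ ℕ).hasSum_iff.2 hsum.hasSum
  have h6 : ∀ N, HasSum (fun n => harmonicHom S n N * z ^ N) (harmonicCoeff S N * z ^ N) :=
    fun N =>
      (summable_norm_harmonicHom ((norm_nonneg z).trans_lt hz) hR hS N).of_norm.hasSum.mul_right _
  exact h4.prod_fiberwise h6

theorem taylorCoeff_Li_div {S : Series X} {R : ℝ} (h0 : 0 < R) (hR : R ≤ 1) (hS : S ∈ Dom R)
    (N : ℕ) : taylorCoeff (fun z => Li S z / (1 - z)) N = harmonicCoeff S N :=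
  taylorCoeff_eq h0 (fun _ hz => hasSum_harmonicCoeff hR hS hz) N

theorem piX_stuffle_mem_Dom {S T : Series X} {R₁ R₂ : ℝ} (h₁ : 0 < R₁) (hR₁ : R₁ ≤ 1) (h₂ : 0 < R₂)
    (hR₂ : R₂ ≤ 1) (hS : S ∈ Dom R₁) (hT : T ∈ Dom R₂) :
    piX (stuffle (piY S) (piY T)) ∈ Dom (R₁ * R₂) := by
  refine mem_Dom_of_bound (mul_pos h₁ h₂) (admissible_of_piX_ne_zero _) fun r hr hrR => ?_
  -- The radii are chosen with `r/R₂ < r₁ < R₁` and then `r/r₁ < r₂ < R₂`, so that `r < r₁r₂`.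
  obtain ⟨r₁, ha, hb⟩ := exists_between ((div_lt_iff₀ h₂).2 hrR)
  have hr₁ : 0 < r₁ := (by positivity : 0 < r / R₂).trans ha
  obtain ⟨r₂, hc, hd⟩ := exists_between
    ((div_lt_iff₀' hr₁).2 ((div_lt_iff₀ h₂).1 ha))
  have hr₂ : 0 < r₂ := (by positivity : 0 < r / r₁).trans hc
  have hlt : r < r₁ * r₂ := (div_lt_iff₀' hr₁).1 hc
  have hr1 : r < 1 := hrR.trans_le (mul_le_one₀ hR₁ h₂.le hR₂)
  have hq : r / (r₁ * r₂) < 1 := (div_lt_one (by positivity)).2 hlt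
  -- The geometric series in `r/(r₁r₂)` bounds `Li/(1-z)`; the factor `2` bounds `|1 - z|` when
  -- returning to `Li`.
  refine ⟨_, (summable_sum_antidiagonal (summable_liNorm hS hR₁ hr₁.le hb)
    (summable_liNorm hT hR₂ hr₂.le hd) (liNorm_nonneg S hr₁.le) (liNorm_nonneg T hr₂.le)).mul_left
    (2 * (1 - r / (r₁ * r₂))⁻¹), fun n z hz => ?_⟩
  set M : ℝ := ∑ q ∈ Finset.HasAntidiagonal.antidiagonal n, liNorm S r₁ q.1 * liNorm T r₂ q.2
    with hM
  have hM0 : 0 ≤ M := Finset.sum_nonneg fun q _ =>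
    mul_nonneg (liNorm_nonneg S hr₁.le _) (liNorm_nonneg T hr₂.le _)
  have hz1 : ‖z‖ < 1 := hz.trans_lt hr1
  have hcoeff : ∀ N, ‖harmonicHom (piX (stuffle (piY S) (piY T))) n N‖ * (r₁ * r₂) ^ N ≤ M := by
    intro N
    rw [harmonicHom_stuffle]
    calc _ ≤ (∑ q ∈ Finset.HasAntidiagonal.antidiagonal n,
          ‖harmonicHom S q.1 N * harmonicHom T q.2 N‖) * (r₁ * r₂) ^ N := by
          gcongr; exact norm_sum_le _ _
      _ = ∑ q ∈ Finset.HasAntidiagonal.antidiagonal n,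
          (‖harmonicHom S q.1 N‖ * r₁ ^ N) * (‖harmonicHom T q.2 N‖ * r₂ ^ N) := by
          rw [Finset.sum_mul]
          refine Finset.sum_congr rfl fun q _ => ?_
          rw [norm_mul, mul_pow]; ring
      _ ≤ M := Finset.sum_le_sum fun q _ => mul_le_mul
          (norm_harmonicHom_le S hr₁.le (hb.trans_le hR₁) _ _)
          (norm_harmonicHom_le T hr₂.le (hd.trans_le hR₂) _ _) (by positivity)
          (liNorm_nonneg S hr₁.le _)
  have hz' : (1 : ℂ) - z ≠ 0 := by
    intro h
    rw [← sub_eq_zero.1 h] at hz1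
    simp at hz1
  have h := hasSum_harmonicHom (piX (stuffle (piY S) (piY T))) n hz1
  have hle : ‖liHom (piX (stuffle (piY S) (piY T))) n z / (1 - z)‖ ≤
      M * (1 - r / (r₁ * r₂))⁻¹ := by
    rw [← h.tsum_eq]
    refine tsum_of_norm_bounded
      ((hasSum_geometric_of_lt_one (by positivity) hq).mul_left M) fun N => ?_
    calc _ ≤ ‖harmonicHom (piX (stuffle (piY S) (piY T))) n N‖ * r ^ N := by
          rw [norm_mul, norm_pow]; gcongr
      _ = ‖harmonicHom (piX (stuffle (piY S) (piY T))) n N‖ * (r₁ * r₂) ^ N *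
          (r / (r₁ * r₂)) ^ N := by
          rw [div_pow]; field_simp
      _ ≤ _ := by gcongr; exact hcoeff N
  have h2 : ‖(1 : ℂ) - z‖ ≤ 2 := by
    refine (norm_sub_le _ _).trans ?_
    rw [norm_one]; linarith
  have hpos : 0 ≤ (1 - r / (r₁ * r₂))⁻¹ := inv_nonneg.2 (by linarith)
  calc ‖liHom (piX (stuffle (piY S) (piY T))) n z‖
      = ‖(1 : ℂ) - z‖ * ‖liHom (piX (stuffle (piY S) (piY T))) n z / (1 - z)‖ := by
        rw [← norm_mul, mul_div_cancel₀ _ hz']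
    _ ≤ 2 * (M * (1 - r / (r₁ * r₂))⁻¹) := by gcongr
    _ = _ := by ring

theorem harmonicCoeff_stuffle {S T : Series X} {R₁ R₂ : ℝ} (h₁ : 0 < R₁) (hR₁ : R₁ ≤ 1)
    (h₂ : 0 < R₂) (hR₂ : R₂ ≤ 1) (hS : S ∈ Dom R₁) (hT : T ∈ Dom R₂) (N : ℕ) :
    harmonicCoeff (piX (stuffle (piY S) (piY T))) N = harmonicCoeff S N * harmonicCoeff T N := by
  rw [harmonicCoeff, harmonicCoeff, harmonicCoeff,
    tsum_mul_tsum_eq_tsum_sum_antidiagonal_of_summable_norm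
      (summable_norm_harmonicHom h₁ hR₁ hS N) (summable_norm_harmonicHom h₂ hR₂ hT N)]
  exact tsum_congr fun n => harmonicHom_stuffle S T n N

theorem H_piY {S : Series X} {R : ℝ} (h0 : 0 < R) (hR : R ≤ 1) (hS : S ∈ Dom R) (N : ℕ) :
    H (piY S) N = harmonicCoeff S N := by
  rw [H, piX_piY hS.1]
  exact taylorCoeff_Li_div h0 hR hS N

end LocalPolylog

open LocalPolylog in
theorem theorem2 (S T : Series X) (hS : S ∈ DomLoc) (hT : T ∈ DomLoc) :
    -- stability of the local domain
    (shuffle S T ∈ DomLoc ∧ piX (stuffle (piY S) (piY T)) ∈ DomLoc) ∧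
    -- Li is multiplicative for the shuffle, on every disc on which both factors are defined
    (∀ R ∈ Set.Ioc (0 : ℝ) 1, S ∈ Dom R → T ∈ Dom R →
      shuffle S T ∈ Dom R ∧
      ∀ z ∈ Metric.ball (0 : ℂ) R, Li (shuffle S T) z = Li S z * Li T z) ∧
    -- Li is unital
    (one X ∈ Dom 1 ∧ ∀ z ∈ Metric.ball (0 : ℂ) 1, Li (one X) z = 1) ∧
    -- H is multiplicative for the stuffle
    (∀ N : ℕ, H (stuffle (piY S) (piY T)) N = H (piY S) N * H (piY T) N) ∧
    -- the Hadamard product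
    (∀ R₁ ∈ Set.Ioc (0 : ℝ) 1, ∀ R₂ ∈ Set.Ioc (0 : ℝ) 1, S ∈ Dom R₁ → T ∈ Dom R₂ →
      piX (stuffle (piY S) (piY T)) ∈ Dom (R₁ * R₂) ∧
      ∀ z ∈ Metric.ball (0 : ℂ) (R₁ * R₂),
        Summable (fun N : ℕ => taylorCoeff (fun x => Li S x / (1 - x)) N *
          taylorCoeff (fun x => Li T x / (1 - x)) N * z ^ N) ∧
        hadamard (fun x => Li S x / (1 - x)) (fun x => Li T x / (1 - x)) z =
          Li (piX (stuffle (piY S) (piY T))) z / (1 - z)) := by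
  have hsh : ∀ R ∈ Set.Ioc (0 : ℝ) 1, S ∈ Dom R → T ∈ Dom R → shuffle S T ∈ Dom R ∧
      ∀ z ∈ Metric.ball (0 : ℂ) R, Li (shuffle S T) z = Li S z * Li T z :=
    fun R hR hS hT => ⟨shuffle_mem_Dom hR.1 hR.2 hS hT, fun z hz =>
      Li_shuffle hR.2 hS hT (by simpa using hz)⟩
  simp only [DomLoc, Set.mem_iUnion, exists_prop] at hS hT ⊢
  obtain ⟨R, hR, hS⟩ := hS
  obtain ⟨R', hR', hT⟩ := hT
  have hprod : ∀ {a b : ℝ}, a ∈ Set.Ioc (0 : ℝ) 1 → b ∈ Set.Ioc (0 : ℝ) 1 →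
      a * b ∈ Set.Ioc (0 : ℝ) 1 := fun ha hb =>
    ⟨mul_pos ha.1 hb.1, mul_le_one₀ ha.2 hb.1.le hb.2⟩
  have hst : piX (stuffle (piY S) (piY T)) ∈ Dom (R * R') :=
    piX_stuffle_mem_Dom hR.1 hR.2 hR'.1 hR'.2 hS hT
  -- The shuffle needs a disc common to both factors, the stuffle only the product of the radii.
  refine ⟨⟨⟨min R R', ⟨lt_min hR.1 hR'.1, min_le_of_left_le hR.2⟩, ?_⟩,
    R * R', hprod hR hR', hst⟩, hsh, ⟨one_mem_Dom, fun z _ => Li_one z⟩, fun N => ?_, ?_⟩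
  · exact shuffle_mem_Dom (lt_min hR.1 hR'.1) (min_le_of_left_le hR.2)
      (Dom_anti (min_le_left _ _) hS) (Dom_anti (min_le_right _ _) hT)
  · rw [H_piY hR.1 hR.2 hS, H_piY hR'.1 hR'.2 hT,
      ← harmonicCoeff_stuffle hR.1 hR.2 hR'.1 hR'.2 hS hT]
    exact taylorCoeff_Li_div (hprod hR hR').1 (hprod hR hR').2 hst N
  · intro R₁ hR₁ R₂ hR₂ hS hT
    have hst : piX (stuffle (piY S) (piY T)) ∈ Dom (R₁ * R₂) :=
      piX_stuffle_mem_Dom hR₁.1 hR₁.2 hR₂.1 hR₂.2 hS hT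
    refine ⟨hst, fun z hz => ?_⟩
    have h := hasSum_harmonicCoeff (hprod hR₁ hR₂).2 hst (z := z) (by simpa using hz)
    simp_rw [harmonicCoeff_stuffle hR₁.1 hR₁.2 hR₂.1 hR₂.2 hS hT,
      ← taylorCoeff_Li_div hR₁.1 hR₁.2 hS, ← taylorCoeff_Li_div hR₂.1 hR₂.2 hT] at h
    exact ⟨h.summable, h.tsum_eq⟩
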